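/- Let $R$ be an associative ring with identity, not necessarily commutative; modules are unital left $R$-modules. A submodule $A\subseteq B$ is *coneat* if $S\otimes_R A\to S\otimes_R B$ is injective for every simple right $R$-module $S$. A module $M$ is *coneat injective* if for every module $B$ and every coneat submodule $A\subseteq B$, every homomorphism $A\to M$ extends to $B$. A *coneat injective envelope* of $M$ is a homomorphism $i\colon M\to E$ with $E$ coneat injective such that every homomorphism from $M$ to a coneat injective module factors through $i$, and every endomorphism $f$ of $E$ with $f\circ i=i$ is an automorphism. A module $B\supseteq A$ is a *coneat essential extension* of $A$ if $A$ is coneat in $B$ and every homomorphism $\varphi\colon B\to X$ such that $\varphi|_A$ is injective and $\varphi(A)$ is coneat in $\varphi(B)$ is injective. (a) Every module $M$ has a coneat injective envelope, and every coneat injective envelope $i\colon M\to E$ is injective and makes $E$ a coneat essential extension of $i(M)\cong M$. (b) For modules $A\subseteq C$ the following are equivalent: 1. $C$ is the coneat injective envelope of $A$, i.e. the inclusion $A\hookrightarrow C$ is a coneat injective envelope. 2. $C$ is coneat injective and is a coneat essential extension of $A$. 3. $C$ is the smallest coneat injective module containing $A$ as a coneat submodule, in either of the following two equivalent senses: $C$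 is coneat injective, $A$ is coneat in $C$, and - (3a) for every coneat injective module $D$ and every injective homomorphism $j\colon A\to D$ with $j(A)$ coneat in $D$, there is an injective homomorphism $C\to D$ that restricts to $j$ on $A$; - (3b) no proper submodule $D\subsetneq C$ with $A\subseteq D$ is coneat injective with $A$ coneat in $D$. 4. $C$ is a maximal coneat essential extension of $A$: it is a coneat essential extension of $A$, and no module $D\supsetneq C$ is a coneat essential extension of $A$. -/

import Mathlib

open scoped TensorProduct

universe u v w w' w''

/-- The relations `(s r) ⊗ a = s ⊗ (r a)` that turn the tensor product over `ℤ` of a right `R`-module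
`S` and a left `R`-module `A` into the tensor product over the (not necessarily commutative)
ring `R`. A right `R`-module is a module over `Rᵐᵒᵖ`, with `s r = MulOpposite.op r • s`. -/
def balancedRelations (R : Type u) [Ring R] (S : Type w') [AddCommGroup S] [Module Rᵐᵒᵖ S]
    (A : Type w) [AddCommGroup A] [Module R A] : Submodule ℤ (S ⊗[ℤ] A) :=
  Submodule.span ℤ {x | ∃ (s : S) (r : R) (a : A),
    x = (MulOpposite.op r • s) ⊗ₜ[ℤ] a - s ⊗ₜ[ℤ] (r • a)}

/-- The tensor product `S ⊗_R A` of a right `R`-module `S` and a left `R`-module `A`,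
an abelian group. -/
abbrev BalancedTensor (R : Type u) [Ring R] (S : Type w') [AddCommGroup S] [Module Rᵐᵒᵖ S]
    (A : Type w) [AddCommGroup A] [Module R A] : Type (max w' w) :=
  (S ⊗[ℤ] A) ⧸ balancedRelations R S A

theorem balancedRelations_le_comap (R : Type u) [Ring R] (S : Type w') [AddCommGroup S]
    [Module Rᵐᵒᵖ S] {A : Type w} [AddCommGroup A] [Module R A] {B : Type w''} [AddCommGroup B]
    [Module R B] (f : A →ₗ[R] B) :
    balancedRelations R S A ≤
      (balancedRelations R S B).comap (LinearMap.lTensor S f.toAddMonoidHom.toIntLinearMap) := by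
  refine Submodule.span_le.2 ?_
  rintro x ⟨s, r, a, rfl⟩
  refine Submodule.subset_span ⟨s, r, f a, ?_⟩
  simp

/-- The map `S ⊗_R A → S ⊗_R B`, `s ⊗ a ↦ s ⊗ f a`, induced by an `R`-linear map `f : A → B`. -/
def balancedTensorMap (R : Type u) [Ring R] (S : Type w') [AddCommGroup S]
    [Module Rᵐᵒᵖ S] {A : Type w} [AddCommGroup A] [Module R A] {B : Type w''} [AddCommGroup B]
    [Module R B] (f : A →ₗ[R] B) : BalancedTensor R S A →ₗ[ℤ] BalancedTensor R S B :=
  Submodule.mapQ (balancedRelations R S A) (balancedRelations R S B)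
    (LinearMap.lTensor S f.toAddMonoidHom.toIntLinearMap) (balancedRelations_le_comap R S f)

/-- `A` is a coneat submodule of `B`: the sequence `0 → A → B → B/A → 0` remains exact when
tensored with any simple right `R`-module `S`. As tensoring is right exact, this says that
`S ⊗_R A → S ⊗_R B` is injective. Every simple right `R`-module is isomorphic to some `R/M`, so it
is enough to take `S` in the universe of `R`. -/
def IsConeat {R : Type u} [Ring R] {B : Type w} [AddCommGroup B] [Module R B]
    (A : Submodule R B) : Prop :=
  ∀ (S : Type u) [AddCommGroup S] [Module Rᵐᵒᵖ S] [IsSimpleModule Rᵐᵒᵖ S],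
    Function.Injective (balancedTensorMap R S A.subtype)

/-- `M` is coneat injective: it is injective with respect to all coneat exact sequences. -/
def IsConeatInjective (R : Type u) [Ring R] (M : Type w) [AddCommGroup M] [Module R M] : Prop :=
  ∀ (B : Type w) [AddCommGroup B] [Module R B] (A : Submodule R B), IsConeat A →
    ∀ f : A →ₗ[R] M, ∃ g : B →ₗ[R] M, g ∘ₗ A.subtype = f

/-- `i : M → E` is a coneat injective envelope of `M`, i.e. an envelope with respect to the class of
coneat injective modules: `E` is coneat injective, every map from `M` to a coneat injective module
factors through `i`, and every endomorphism `f` of `E` with `f ∘ i = i` is an automorphism. -/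
structure IsConeatInjectiveEnvelope {R : Type u} [Ring R] {M E : Type w} [AddCommGroup M]
    [Module R M] [AddCommGroup E] [Module R E] (i : M →ₗ[R] E) : Prop where
  coneatInjective : IsConeatInjective R E
  factors : ∀ (E' : Type w) [AddCommGroup E'] [Module R E'], IsConeatInjective R E' →
    ∀ j : M →ₗ[R] E', ∃ f : E →ₗ[R] E', f ∘ₗ i = j
  bijective : ∀ f : E →ₗ[R] E, f ∘ₗ i = i → Function.Bijective f

/-- `B` is a coneat essential extension of its submodule `A`: `A` is coneat in `B`, and every map
`φ : B → X` whose restriction to `A` is injective and for which `φ(A)` is a coneat submodule of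
`φ(B)` is injective. -/
def IsConeatEssential {R : Type u} [Ring R] {B : Type w} [AddCommGroup B] [Module R B]
    (A : Submodule R B) : Prop :=
  IsConeat A ∧ ∀ (X : Type w) [AddCommGroup X] [Module R X] (φ : B →ₗ[R] X),
    Function.Injective (φ ∘ₗ A.subtype) → IsConeat (A.map φ.rangeRestrict) → Function.Injective φ

/-- `C` is the smallest coneat injective module that contains `A` as a coneat submodule: it is one,
and it embeds over `A` into every coneat injective module `D` that contains (an isomorphic copy,
via `j`, of) `A` as a coneat submodule. -/
def IsSmallestConeatInjective {R : Type u} [Ring R] {C : Type w} [AddCommGroup C] [Module R C]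
    (A : Submodule R C) : Prop :=
  IsConeatInjective R C ∧ IsConeat A ∧
    ∀ (D : Type w) [AddCommGroup D] [Module R D] (j : A →ₗ[R] D), IsConeatInjective R D →
      Function.Injective j → IsConeat (LinearMap.range j) →
        ∃ g : C →ₗ[R] D, Function.Injective g ∧ g ∘ₗ A.subtype = j

/-- `C` is a minimal coneat injective module that contains `A` as a coneat submodule: it is one, and
no proper submodule `D` of `C` with `A ≤ D` is one. Here `A.submoduleOf D` is `A`, regarded as a
submodule of `D`. -/
def IsMinimalConeatInjective {R : Type u} [Ring R] {C : Type w} [AddCommGroup C] [Module R C]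
    (A : Submodule R C) : Prop :=
  IsConeatInjective R C ∧ IsConeat A ∧
    ∀ D : Submodule R C, A ≤ D → IsConeatInjective R D → IsConeat (A.submoduleOf D) → D = ⊤

/-- `C` is a maximal coneat essential extension of `A`: it is a coneat essential extension of `A`,
and no module `D` properly containing `C` (via an embedding `k`) is one. -/
def IsMaximalConeatEssential {R : Type u} [Ring R] {C : Type w} [AddCommGroup C] [Module R C]
    (A : Submodule R C) : Prop :=
  IsConeatEssential A ∧
    ∀ (D : Type w) [AddCommGroup D] [Module R D] (k : C →ₗ[R] D), Function.Injective k →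
      IsConeatEssential (A.map k) → Function.Surjective k

/-! The circle is an injective cogenerator of abelian groups, so by tensor-hom adjunction `S ⊗_R A →
S ⊗_R B` is injective iff every map from `A` to the character module of `S` extends to `B`
(`balancedTensorMap_injective_iff`). Coneatness is thus an extension property against a set of
modules, and the product of these over all maps out of `M` is coneat injective and contains `M` as a
coneat submodule.

That product `P` is also a compact Hausdorff module. Its endomorphisms fixing `M` form a closed
subset of `P → P`, hence a compact right topological semigroup. An idempotent `e` of a minimal
closed left ideal makes every `e f e` invertible relative to `e`
(`exists_idempotent_forall_invertible`), which is exactly what turns `e(P)` into an envelope.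

Each characterization in (b) is compared with an envelope `E` of `A`: maps `g : E → C` and `k : C →
E` over `A` make `k ∘ g` bijective, and the property at hand upgrades `g` or `k` to an isomorphism.
-/

/-! ### Idempotents in compact right topological semigroups -/

/-- A compact Hausdorff right topological semigroup has an idempotent `e` such that
`e * f * e` is invertible with respect to `e` for every `f`. -/
theorem exists_idempotent_forall_invertible {M : Type*} [Nonempty M] [Semigroup M]
    [TopologicalSpace M] [CompactSpace M] [T2Space M]
    (hc : ∀ r : M, Continuous (· * r)) :
    ∃ e : M, e * e = e ∧ ∀ f : M, ∃ k : M, k * (e * f * e) = e ∧ (e * f * e) * k = e := by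
  -- The closed nonempty left ideals; compactness keeps intersections of chains nonempty, so Zorn
  -- gives a minimal one.
  let S : Set (Set M) := {N | IsClosed N ∧ N.Nonempty ∧ ∀ s, ∀ n ∈ N, s * n ∈ N}
  obtain ⟨N, hN⟩ : ∃ N, Minimal (· ∈ S) N := by
    refine zorn_superset _ fun c hcs hc' => ?_
    refine ⟨⋂₀ c, ⟨isClosed_sInter fun t ht => (hcs ht).1, ?_, fun s n hn t ht =>
      (hcs ht).2.2 s n (hn t ht)⟩, fun s hs => Set.sInter_subset_of_mem hs⟩
    obtain rfl | hcnemp := c.eq_empty_or_nonempty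
    · rw [Set.sInter_empty]
      exact Set.univ_nonempty
    · have hdir : DirectedOn (fun a b : Set M => a ⊇ b) c := fun a ha b hb =>
        (hc'.total ha hb).elim (fun h => ⟨a, ha, subset_rfl, h⟩) fun h => ⟨b, hb, h, subset_rfl⟩
      exact IsCompact.nonempty_sInter_of_directed_nonempty_isCompact_isClosed
        (hS := hcnemp.to_subtype) hdir (fun t ht => (hcs ht).2.1) (fun t ht => (hcs ht).1.isCompact)
        (fun t ht => (hcs ht).1)
  obtain ⟨hcl, hne, hid⟩ := hN.prop
  have hmul : ∀ x ∈ N, ∀ y ∈ N, ∃ z ∈ N, z * x = y := by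
    intro x hx y hy
    -- `N x` is again a closed left ideal, contained in `N`.
    have h : (· * x) '' N = N := by
      refine hN.eq_of_subset ⟨(hc x).isClosedMap _ hcl, hne.image _, ?_⟩ ?_
      · rintro s _ ⟨n, hn, rfl⟩
        exact ⟨s * n, hid s n hn, mul_assoc _ _ _⟩
      · rintro _ ⟨n, hn, rfl⟩
        exact hid n x hx
    rw [← h] at hy
    exact hy
  obtain ⟨e, he, hee⟩ := exists_idempotent_in_compact_subsemigroup hc N hne hcl.isCompact
    (fun m _ n hn => hid m n hn)
  have key : ∀ f : M, ∃ k : M, e * k * e = k ∧ k * (e * f * e) = e := by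
    intro f
    obtain ⟨z, -, hz⟩ := hmul (e * f * e) (hid _ _ he) e he
    refine ⟨e * z * e, by simp only [mul_assoc, hee, ← mul_assoc e e], ?_⟩
    calc e * z * e * (e * f * e) = e * (z * ((e * e) * f * e)) := by simp only [mul_assoc]
      _ = e := by rw [hee, hz, hee]
  refine ⟨e, hee, fun f => ?_⟩
  obtain ⟨k, hk, hkf⟩ := key f
  -- The left inverse `k` of `e f e` has its own left inverse `l`; as in any monoid, `l = e f e`, so
  -- `k` is two-sided.
  obtain ⟨l, hl, hlk⟩ := key k
  rw [hk] at hlk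
  refine ⟨k, hkf, ?_⟩
  have h1 : l = e * f * e := by
    calc l = l * e := by rw [← hl, mul_assoc (e * l), hee]
      _ = l * (k * (e * f * e)) := by rw [hkf]
      _ = e * (e * f * e) := by rw [← mul_assoc, hlk]
      _ = e * f * e := by simp only [← mul_assoc, hee]
  rw [← h1, hlk]

/-! ### Characters with values in the circle -/

/-- The circle group. -/
abbrev CircleGroup : Type := AddCircle (1 : ℝ)

/-- The circle is divisible, hence injective by Baer's criterion. It is used instead of `ℚ/ℤ`
because it is compact. -/
theorem circleGroup_extension {U V : Type*} [AddCommGroup U] [AddCommGroup V] (f : U →+ V)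
    (hf : Function.Injective f) (g : U →+ CircleGroup) : ∃ h : V →+ CircleGroup, h.comp f = g := by
  let _ : DivisibleBy ℝ ℕ := AddGroup.divisibleByNatOfDivisibleByInt ℝ
  let _ : DivisibleBy CircleGroup ℕ := QuotientAddGroup.divisibleBy _
  let _ : DivisibleBy CircleGroup ℤ := AddGroup.divisibleByIntOfDivisibleByNat _
  exact (Module.Baer.of_divisible CircleGroup).extension_property_addMonoidHom f hf g

/-- Characters to `ℚ/ℤ` separate points, and `ℚ/ℤ` embeds in `ℝ/ℤ`. -/
theorem exists_circleGroup_apply_ne_zero {U : Type*} [AddCommGroup U] {x : U} (hx : x ≠ 0) :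
    ∃ c : U →+ CircleGroup, c x ≠ 0 := by
  obtain ⟨c, hc⟩ := CharacterModule.exists_character_apply_ne_zero_of_ne_zero hx
  let q : AddCircle (1 : ℚ) →+ CircleGroup :=
    QuotientAddGroup.map _ _ (Rat.castHom ℝ).toAddMonoidHom (by
      rw [AddSubgroup.zmultiples_le]
      exact ⟨1, by simp⟩)
  refine ⟨q.comp c, fun h => hc ?_⟩
  have hq : Function.Injective q := by
    rw [injective_iff_map_eq_zero]
    intro a
    induction a using QuotientAddGroup.induction_on with
    | H a =>
      intro ha
      change ((a : ℝ) : CircleGroup) = 0 at ha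
      rw [AddCircle.coe_eq_zero_iff] at ha
      obtain ⟨n, hn⟩ := ha
      refine (AddCircle.coe_eq_zero_iff (1 : ℚ)).2 ⟨n, ?_⟩
      simp only [zsmul_eq_mul, mul_one] at hn ⊢
      exact_mod_cast hn
  exact hq (h.trans (map_zero q).symm)

/-- The left `R`-module of characters of a right `R`-module. -/
def CharDual (N : Type w) [AddCommGroup N] : Type w := N →+ CircleGroup

namespace CharDual

variable {R : Type u} [Ring R] {N : Type w} [AddCommGroup N] [Module Rᵐᵒᵖ N]

noncomputable instance : AddCommGroup (CharDual N) := inferInstanceAs (AddCommGroup (N →+ CircleGroup))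

instance : FunLike (CharDual N) N CircleGroup := inferInstanceAs (FunLike (N →+ CircleGroup) _ _)

instance : AddMonoidHomClass (CharDual N) N CircleGroup :=
  inferInstanceAs (AddMonoidHomClass (N →+ CircleGroup) _ _)

@[ext] theorem ext {c d : CharDual N} (h : ∀ n, c n = d n) : c = d := DFunLike.ext _ _ h

@[simp] theorem zero_apply (n : N) : (0 : CharDual N) n = 0 := rfl

@[simp] theorem add_apply (c d : CharDual N) (n : N) : (c + d) n = c n + d n := rfl

noncomputable instance : Module R (CharDual N) where
  smul r c := AddMonoidHom.comp (show N →+ CircleGroup from c)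
    (DistribSMul.toAddMonoidHom N (MulOpposite.op r))
  one_smul c := ext fun n => congrArg c (one_smul _ n)
  mul_smul r s c := ext fun n => congrArg c (mul_smul (MulOpposite.op s) (MulOpposite.op r) n)
  smul_zero r := rfl
  smul_add r c d := rfl
  add_smul r s c := ext fun n => by
    change c ((MulOpposite.op (r + s)) • n) = c (MulOpposite.op r • n) + c (MulOpposite.op s • n)
    rw [MulOpposite.op_add, add_smul, map_add]
  zero_smul c := ext fun n => by
    change c ((MulOpposite.op (0 : R)) • n) = 0
    rw [MulOpposite.op_zero, zero_smul, map_zero]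

@[simp] theorem smul_apply (r : R) (c : CharDual N) (n : N) :
    (r • c) n = c (MulOpposite.op r • n) := rfl

instance : TopologicalSpace (CharDual N) := TopologicalSpace.induced (fun c => (c : N → CircleGroup))
  inferInstance

theorem isEmbedding_coe : Topology.IsEmbedding (fun c : CharDual N => (c : N → CircleGroup)) :=
  ⟨⟨rfl⟩, DFunLike.coe_injective⟩

theorem continuous_apply (n : N) : Continuous fun c : CharDual N => c n :=
  (_root_.continuous_apply n).comp isEmbedding_coe.continuous

theorem continuous_of_apply {X : Type*} [TopologicalSpace X] {f : X → CharDual N}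
    (h : ∀ n, Continuous fun x => f x n) : Continuous f :=
  isEmbedding_coe.continuous_iff.2 (continuous_pi h)

instance : T2Space (CharDual N) := isEmbedding_coe.t2Space

/-- Additivity is a closed condition in a product of circles, which is compact by Tychonoff. -/
instance : CompactSpace (CharDual N) := by
  have h : Topology.IsClosedEmbedding (fun c : CharDual N => (c : N → CircleGroup)) := by
    refine ⟨isEmbedding_coe, ?_⟩
    have : Set.range (fun c : CharDual N => (c : N → CircleGroup)) =
        ⋂ (x : N) (y : N), {f | f (x + y) = f x + f y} := by
      ext f
      simp only [Set.mem_range, Set.mem_iInter]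
      refine ⟨?_, fun h => ⟨AddMonoidHom.mk' f h, rfl⟩⟩
      rintro ⟨c, rfl⟩ x y
      exact map_add c x y
    rw [this]
    exact isClosed_iInter fun x => isClosed_iInter fun y =>
      isClosed_eq (by fun_prop) (by fun_prop)
  exact h.compactSpace

instance : ContinuousAdd (CharDual N) :=
  ⟨continuous_of_apply fun n => ((continuous_apply n).comp continuous_fst).add
    ((continuous_apply n).comp continuous_snd)⟩

instance : ContinuousConstSMul R (CharDual N) :=
  ⟨fun r => continuous_of_apply fun n => continuous_apply (MulOpposite.op r • n)⟩

/-- Precomposition with an equivalence of right modules. -/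
noncomputable def congr {N' : Type w'} [AddCommGroup N'] [Module Rᵐᵒᵖ N'] (e : N ≃ₗ[Rᵐᵒᵖ] N') :
    CharDual N ≃ₗ[R] CharDual N' where
  toFun c := AddMonoidHom.comp (show N →+ CircleGroup from c) e.symm.toLinearMap.toAddMonoidHom
  invFun c := AddMonoidHom.comp (show N' →+ CircleGroup from c) e.toLinearMap.toAddMonoidHom
  map_add' _ _ := rfl
  map_smul' r c := ext fun n => congrArg c (e.symm.map_smul (MulOpposite.op r) n).symm
  left_inv c := ext fun n => congrArg c (e.symm_apply_apply n)
  right_inv c := ext fun n => congrArg c (e.apply_symm_apply n)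

end CharDual

/-! ### Coneatness as an extension property -/

/-- Every homomorphism to `Q` extends along `f`. -/
def ExtendsAlong {R : Type u} [Ring R] (Q : Type w) [AddCommGroup Q] [Module R Q] {A : Type w'}
    [AddCommGroup A] [Module R A] {B : Type w''} [AddCommGroup B] [Module R B]
    (f : A →ₗ[R] B) : Prop :=
  ∀ g : A →ₗ[R] Q, ∃ h : B →ₗ[R] Q, h ∘ₗ f = g

section
variable {R : Type u} [Ring R] {A : Type w} [AddCommGroup A] [Module R A]
  {B : Type w'} [AddCommGroup B] [Module R B]

theorem ExtendsAlong.congr {Q Q' : Type*} [AddCommGroup Q] [Module R Q] [AddCommGroup Q']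
    [Module R Q'] (e : Q ≃ₗ[R] Q') {f : A →ₗ[R] B} (h : ExtendsAlong Q f) :
    ExtendsAlong Q' f := by
  intro g
  obtain ⟨k, hk⟩ := h (e.symm.toLinearMap ∘ₗ g)
  refine ⟨e.toLinearMap ∘ₗ k, ?_⟩
  rw [LinearMap.comp_assoc, hk]
  ext x
  simp

/-- A homomorphism into the character module of `N` as a character of the tensor product. -/
noncomputable def charOfHom (N : Type w'') [AddCommGroup N] [Module Rᵐᵒᵖ N] (g : A →ₗ[R] CharDual N) :
    BalancedTensor R N A →+ CircleGroup :=
  ((balancedRelations R N A).liftQ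
    (TensorProduct.liftAddHom
      ((AddMonoidHom.mk' (fun n => AddMonoidHom.mk' (fun a => g a n) (by simp))
        (fun x y => by ext a; simp))) (fun r n a => by simp; rfl)).toIntLinearMap (by
      refine Submodule.span_le.2 ?_
      rintro x ⟨s, r, a, rfl⟩
      simp)).toAddMonoidHom

/-- The surjective half of the tensor-hom adjunction. -/
theorem exists_charOfHom_eq (N : Type w'') [AddCommGroup N] [Module Rᵐᵒᵖ N]
    (c : BalancedTensor R N A →+ CircleGroup) : ∃ g : A →ₗ[R] CharDual N, charOfHom N g = c := by
  have hbal : ∀ (n : N) (r : R) (a : A),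
      (Submodule.Quotient.mk ((MulOpposite.op r • n) ⊗ₜ[ℤ] a) : BalancedTensor R N A) =
        Submodule.Quotient.mk (n ⊗ₜ[ℤ] (r • a)) := fun n r a =>
    (Submodule.Quotient.eq _).2 (Submodule.subset_span ⟨n, r, a, rfl⟩)
  refine ⟨{ toFun := fun a => AddMonoidHom.mk'
              (fun n => c (Submodule.Quotient.mk (n ⊗ₜ[ℤ] a))) fun x y => ?_
            map_add' := fun a b => CharDual.ext fun n => ?_
            map_smul' := fun r a => CharDual.ext fun n => ?_ }, ?_⟩
  · rw [TensorProduct.add_tmul, Submodule.Quotient.mk_add, map_add]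
  · change c _ = c _ + c _
    rw [TensorProduct.tmul_add, Submodule.Quotient.mk_add, map_add]
  · exact congrArg c (hbal n r a).symm
  · ext x
    obtain ⟨x, rfl⟩ := Submodule.Quotient.mk_surjective _ x
    induction x with
    | zero => simp
    | tmul n a => rfl
    | add x y hx hy => rw [Submodule.Quotient.mk_add, map_add, map_add, hx, hy]

theorem charOfHom_balancedTensorMap (N : Type w'') [AddCommGroup N] [Module Rᵐᵒᵖ N]
    (f : A →ₗ[R] B) (g : B →ₗ[R] CharDual N) (x : BalancedTensor R N A) :
    charOfHom N g (balancedTensorMap R N f x) = charOfHom N (g ∘ₗ f) x := by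
  obtain ⟨x, rfl⟩ := Submodule.Quotient.mk_surjective _ x
  induction x with
  | zero => simp
  | tmul n a => rfl
  | add x y hx hy => simp only [Submodule.Quotient.mk_add, map_add, hx, hy]

/-- Under the adjunction, extending a map to `CharDual N` means extending a character of `N ⊗_R A`
to `N ⊗_R B`. All characters extend along an injection; conversely, a nonzero kernel element is
detected by a character, which then cannot extend. -/
theorem balancedTensorMap_injective_iff (N : Type w'') [AddCommGroup N] [Module Rᵐᵒᵖ N]
    (f : A →ₗ[R] B) :
    Function.Injective (balancedTensorMap R N f) ↔ ExtendsAlong (CharDual N) f := by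
  constructor
  · intro hf g
    obtain ⟨c, hc⟩ := circleGroup_extension (balancedTensorMap R N f).toAddMonoidHom hf
      (charOfHom N g)
    obtain ⟨h, rfl⟩ := exists_charOfHom_eq N c
    refine ⟨h, LinearMap.ext fun a => CharDual.ext fun n => ?_⟩
    exact DFunLike.congr_fun hc (Submodule.Quotient.mk (n ⊗ₜ[ℤ] a))
  · intro hf
    rw [injective_iff_map_eq_zero]
    intro x hx
    by_contra hne
    obtain ⟨c, hc⟩ := exists_circleGroup_apply_ne_zero hne
    obtain ⟨g, rfl⟩ := exists_charOfHom_eq N c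
    obtain ⟨h, rfl⟩ := hf g
    rw [← charOfHom_balancedTensorMap, hx, map_zero] at hc
    exact hc rfl

end

/-- The right ideals that are maximal or zero. -/
abbrev TestRightIdeal (R : Type u) [Ring R] : Type u :=
  {m : Submodule Rᵐᵒᵖ Rᵐᵒᵖ // IsCoatom m ∨ m = ⊥}

/-- Injective homomorphisms with coneat range, described by the extension of homomorphisms
to character modules. -/
def ConeatHom {R : Type u} [Ring R] {A : Type w} [AddCommGroup A] [Module R A] {B : Type w'}
    [AddCommGroup B] [Module R B] (f : A →ₗ[R] B) : Prop :=
  ∀ m : TestRightIdeal R, ExtendsAlong (CharDual (Rᵐᵒᵖ ⧸ m.1)) f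

section
variable {R : Type u} [Ring R] {A : Type w} [AddCommGroup A] [Module R A]
  {B : Type w'} [AddCommGroup B] [Module R B] {C : Type w''} [AddCommGroup C] [Module R C]

/-- The homomorphism to the character module of `R` given by a character. -/
noncomputable def homOfChar (c : A →+ CircleGroup) : A →ₗ[R] CharDual Rᵐᵒᵖ where
  toFun a := AddMonoidHom.mk' (fun r => c (r.unop • a)) fun r s => by
    rw [MulOpposite.unop_add, add_smul, map_add]
  map_add' a b := CharDual.ext fun r => by
    change c _ = c _ + c _
    rw [smul_add, map_add]
  map_smul' r a := CharDual.ext fun s => by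
    change c _ = c ((s.unop * r) • a)
    rw [mul_smul]

@[simp] theorem homOfChar_apply (c : A →+ CircleGroup) (a : A) (r : Rᵐᵒᵖ) :
    homOfChar c a r = c (r.unop • a) := rfl

theorem homOfChar_one (g : A →ₗ[R] CharDual Rᵐᵒᵖ) :
    homOfChar (AddMonoidHom.mk' (fun a => g a 1) (by simp)) = g := by
  refine LinearMap.ext fun a => CharDual.ext fun r => ?_
  change g (r.unop • a) 1 = g a r
  simp

/-- Maps to the character module of the regular module are just characters of the underlying group,
via evaluation at `1`. This is why the zero ideal among the test ideals encodes injectivity. -/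
theorem injective_iff_extendsAlong_charDual (f : A →ₗ[R] B) :
    Function.Injective f ↔ ExtendsAlong (CharDual Rᵐᵒᵖ) f := by
  constructor
  · intro hf g
    obtain ⟨c, hc⟩ := circleGroup_extension f.toAddMonoidHom hf
      (AddMonoidHom.mk' (fun a => g a 1) (by simp))
    refine ⟨homOfChar c, ?_⟩
    rw [← homOfChar_one g, ← hc]
    refine LinearMap.ext fun a => CharDual.ext fun r => ?_
    simp
  · intro hf
    rw [injective_iff_map_eq_zero]
    intro x hx
    by_contra hne
    obtain ⟨c, hc⟩ := exists_circleGroup_apply_ne_zero hne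
    obtain ⟨h, hh⟩ := hf (homOfChar c)
    have h1 : homOfChar (R := R) c x = 0 := by rw [← hh, LinearMap.comp_apply, hx, map_zero]
    refine hc ?_
    simpa using DFunLike.congr_fun h1 (1 : Rᵐᵒᵖ)

theorem ExtendsAlong.of_comp {Q : Type*} [AddCommGroup Q] [Module R Q] {f : A →ₗ[R] B}
    {g : B →ₗ[R] C} (h : ExtendsAlong Q (g ∘ₗ f)) : ExtendsAlong Q f := fun k => by
  obtain ⟨l, hl⟩ := h k
  exact ⟨l ∘ₗ g, hl⟩

theorem ConeatHom.of_comp {f : A →ₗ[R] B} {g : B →ₗ[R] C} (h : ConeatHom (g ∘ₗ f)) :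
    ConeatHom f := fun m => (h m).of_comp

theorem extendsAlong_equiv_comp {Q : Type*} [AddCommGroup Q] [Module R Q] (f : A →ₗ[R] B)
    (e : A ≃ₗ[R] C) (g : C →ₗ[R] B) (hf : g ∘ₗ e.toLinearMap = f) :
    ExtendsAlong Q f ↔ ExtendsAlong Q g := by
  subst hf
  constructor
  · intro h k
    obtain ⟨l, hl⟩ := h (k ∘ₗ e.toLinearMap)
    refine ⟨l, LinearMap.ext fun x => ?_⟩
    simpa using LinearMap.congr_fun hl (e.symm x)
  · intro h k
    obtain ⟨l, hl⟩ := h (k ∘ₗ e.symm.toLinearMap)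
    refine ⟨l, LinearMap.ext fun x => ?_⟩
    simpa using LinearMap.congr_fun hl (e x)

/-- Simple right modules are the quotients by maximal right ideals; the zero ideal costs nothing
because an inclusion is injective. -/
theorem isConeat_iff_coneatHom (A : Submodule R B) : IsConeat A ↔ ConeatHom A.subtype := by
  constructor
  · rintro h ⟨m, hm | rfl⟩
    · have : IsSimpleModule Rᵐᵒᵖ (Rᵐᵒᵖ ⧸ m) := isSimpleModule_iff_isCoatom.2 hm
      exact (balancedTensorMap_injective_iff _ _).1 (h (Rᵐᵒᵖ ⧸ m))
    · exact ((injective_iff_extendsAlong_charDual _).1 A.subtype_injective).congr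
        (CharDual.congr (Submodule.quotEquivOfEqBot (⊥ : Submodule Rᵐᵒᵖ Rᵐᵒᵖ) rfl).symm)
  · intro h S _ _ _
    obtain ⟨m, hm, ⟨e⟩⟩ := isSimpleModule_iff_quot_maximal.1 (‹_› : IsSimpleModule Rᵐᵒᵖ S)
    exact (balancedTensorMap_injective_iff _ _).2
      ((h ⟨m, Or.inl hm.out⟩).congr (CharDual.congr e.symm))

theorem ConeatHom.injective {f : A →ₗ[R] B} (h : ConeatHom f) : Function.Injective f :=
  (injective_iff_extendsAlong_charDual f).2 ((h ⟨⊥, Or.inr rfl⟩).congr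
    (CharDual.congr (Submodule.quotEquivOfEqBot (⊥ : Submodule Rᵐᵒᵖ Rᵐᵒᵖ) rfl)))

theorem coneatHom_iff_of_injective {f : A →ₗ[R] B} (hf : Function.Injective f) :
    ConeatHom f ↔ IsConeat (LinearMap.range f) := by
  rw [isConeat_iff_coneatHom]
  exact forall_congr' fun m => extendsAlong_equiv_comp _ (LinearEquiv.ofInjective f hf) _ rfl

theorem ConeatHom.isConeat_range {f : A →ₗ[R] B} (h : ConeatHom f) :
    IsConeat (LinearMap.range f) := (coneatHom_iff_of_injective h.injective).1 h

theorem isConeatInjective_iff {M : Type w} [AddCommGroup M] [Module R M] :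
    IsConeatInjective R M ↔ ∀ (A B : Type w) [AddCommGroup A] [Module R A] [AddCommGroup B]
      [Module R B] (f : A →ₗ[R] B), ConeatHom f → ExtendsAlong M f := by
  constructor
  · intro h A B _ _ _ _ f hf
    exact (extendsAlong_equiv_comp f (LinearEquiv.ofInjective f hf.injective) _ rfl).2
      (h B _ hf.isConeat_range)
  · intro h B _ _ A hA
    exact h A B A.subtype ((isConeat_iff_coneatHom A).1 hA)

theorem IsConeatInjective.extend {M : Type w} [AddCommGroup M] [Module R M]
    (h : IsConeatInjective R M) {A B : Type w} [AddCommGroup A] [Module R A] [AddCommGroup B]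
    [Module R B] {f : A →ₗ[R] B} (hf : ConeatHom f) (g : A →ₗ[R] M) :
    ∃ k : B →ₗ[R] M, k ∘ₗ f = g := isConeatInjective_iff.1 h A B f hf g

theorem IsConeatInjective.of_retract {M N : Type w} [AddCommGroup M] [Module R M]
    [AddCommGroup N] [Module R N] (h : IsConeatInjective R M) (s : N →ₗ[R] M) (r : M →ₗ[R] N)
    (hrs : r ∘ₗ s = LinearMap.id) : IsConeatInjective R N := by
  intro B _ _ A hA f
  obtain ⟨g, hg⟩ := h B A hA (s ∘ₗ f)
  refine ⟨r ∘ₗ g, ?_⟩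
  rw [LinearMap.comp_assoc, hg, ← LinearMap.comp_assoc, hrs, LinearMap.id_comp]

theorem IsConeatInjective.of_equiv {M N : Type w} [AddCommGroup M] [Module R M]
    [AddCommGroup N] [Module R N] (h : IsConeatInjective R M) (e : M ≃ₗ[R] N) :
    IsConeatInjective R N :=
  h.of_retract e.symm.toLinearMap e.toLinearMap (LinearMap.ext fun x => e.apply_symm_apply x)

end

/-! ### Enough coneat injective modules -/

section
variable (R : Type u) [Ring R]

/-- A product of character modules into which `M` embeds as a coneat submodule. -/
abbrev CharProduct (M : Type w) [AddCommGroup M] [Module R M] : Type (max u w) :=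
  ∀ p : (Σ m : TestRightIdeal R, M →ₗ[R] CharDual (Rᵐᵒᵖ ⧸ m.1)), CharDual (Rᵐᵒᵖ ⧸ p.1.1)

/-- The evaluation map. -/
noncomputable def toCharProduct (M : Type w) [AddCommGroup M] [Module R M] :
    M →ₗ[R] CharProduct R M := LinearMap.pi fun p => p.2

/-- Each test map is itself a coordinate of the product, so the projection to it is an extension. -/
theorem coneatHom_toCharProduct (M : Type w) [AddCommGroup M] [Module R M] :
    ConeatHom (toCharProduct R M) := fun m g =>
  ⟨LinearMap.proj (R := R)
    (φ := fun p : (Σ m : TestRightIdeal R, M →ₗ[R] CharDual (Rᵐᵒᵖ ⧸ m.1)) =>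
      CharDual (Rᵐᵒᵖ ⧸ p.1.1)) ⟨m, g⟩, LinearMap.ext fun _ => rfl⟩

theorem isConeatInjective_charProduct (M : Type w) [AddCommGroup M] [Module R M] :
    IsConeatInjective R (CharProduct R M) := by
  refine isConeatInjective_iff.2 fun A B _ _ _ _ f hf g => ?_
  choose k hk using fun p : (Σ m : TestRightIdeal R, M →ₗ[R] CharDual (Rᵐᵒᵖ ⧸ m.1)) =>
    hf p.1 (LinearMap.proj p ∘ₗ g)
  exact ⟨LinearMap.pi k, LinearMap.ext fun a => funext fun p => LinearMap.congr_fun (hk p) a⟩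

end

/-! ### Existence of envelopes -/

section
variable {R : Type u} [Ring R]

/-- Among the endomorphisms of a compact module that fix `i` there is an idempotent `e` such that
every `e f e` is invertible with respect to `e`. -/
theorem exists_idempotent_endomorphism {M : Type w} [AddCommGroup M] [Module R M]
    {P : Type w'} [AddCommGroup P] [Module R P] [TopologicalSpace P] [CompactSpace P] [T2Space P]
    [ContinuousAdd P] [ContinuousConstSMul R P] (i : M →ₗ[R] P) :
    ∃ e : P →ₗ[R] P, e ∘ₗ i = i ∧ e ∘ₗ e = e ∧ ∀ f : P →ₗ[R] P, f ∘ₗ i = i →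
      ∃ k : P →ₗ[R] P, k ∘ₗ (e ∘ₗ f ∘ₗ e) = e ∧ (e ∘ₗ f ∘ₗ e) ∘ₗ k = e := by
  let S : Submonoid (Module.End R P) :=
    { carrier := {f | f ∘ₗ i = i}
      one_mem' := rfl
      mul_mem' := fun {f g} (hf : f ∘ₗ i = i) (hg : g ∘ₗ i = i) => by
        change f ∘ₗ (g ∘ₗ i) = i
        rw [hg, hf] }
  let φ : S → P → P := fun f => f.1
  let _ : TopologicalSpace S := TopologicalSpace.induced φ inferInstance
  have hemb : Topology.IsEmbedding φ :=
    ⟨⟨rfl⟩, fun f g h => Subtype.ext (LinearMap.ext fun x => congrFun h x)⟩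
  have hrange : Set.range φ = (⋂ (x : P) (y : P), {f | f (x + y) = f x + f y}) ∩
      ((⋂ (r : R) (x : P), {f | f (r • x) = r • f x}) ∩ ⋂ a : M, {f | f (i a) = i a}) := by
    ext f
    simp only [Set.mem_range, Set.mem_inter_iff, Set.mem_iInter]
    constructor
    · rintro ⟨g, rfl⟩
      exact ⟨map_add g.1, map_smul g.1, LinearMap.congr_fun g.2⟩
    · rintro ⟨h1, h2, h3⟩
      exact ⟨⟨{ toFun := f, map_add' := h1, map_smul' := h2 }, LinearMap.ext h3⟩, rfl⟩
  have hclosed : IsClosed (Set.range φ) := by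
    rw [hrange]
    refine IsClosed.inter ?_ (IsClosed.inter ?_ ?_)
    · exact isClosed_iInter fun x => isClosed_iInter fun y =>
        isClosed_eq (continuous_apply _) ((continuous_apply x).add (continuous_apply y))
    · exact isClosed_iInter fun r => isClosed_iInter fun x =>
        isClosed_eq (continuous_apply _) ((continuous_apply x).const_smul r)
    · exact isClosed_iInter fun a => isClosed_eq (continuous_apply _) continuous_const
  have : CompactSpace S := (Topology.IsClosedEmbedding.mk hemb hclosed).compactSpace
  have : T2Space S := hemb.t2Space
  -- Evaluating `f ∘ g` at `x` is evaluating `f` at `g x`, so right multiplication is continuous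
  -- even though endomorphisms need not be.
  obtain ⟨e, hee, he⟩ := exists_idempotent_forall_invertible (M := S) fun g =>
    hemb.continuous_iff.2 (continuous_pi fun x =>
      (continuous_apply (g.1 x)).comp hemb.continuous)
  refine ⟨e.1, e.2, congrArg Subtype.val hee, fun f hf => ?_⟩
  obtain ⟨k, hk, hk'⟩ := he ⟨f, hf⟩
  exact ⟨k.1, congrArg Subtype.val hk, congrArg Subtype.val hk'⟩

/-- The envelope is the retract `e(P)`. An endomorphism `f` of it fixing `M` extends to `P` by
precomposing with `e`; the extension `F` satisfies `e F e = F`, so invertibility relative to `e`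
says that `f` is bijective. -/
theorem exists_isConeatInjectiveEnvelope_of_compact {M P : Type w} [AddCommGroup M] [Module R M]
    [AddCommGroup P] [Module R P] [TopologicalSpace P] [CompactSpace P] [T2Space P]
    [ContinuousAdd P] [ContinuousConstSMul R P] {j : M →ₗ[R] P} (hj : ConeatHom j)
    (hP : IsConeatInjective R P) :
    ∃ (E : Type w) (_ : AddCommGroup E) (_ : Module R E) (i : M →ₗ[R] E),
      IsConeatInjectiveEnvelope i := by
  obtain ⟨e, hei, hee, he⟩ := exists_idempotent_endomorphism j
  have hee' : ∀ x, e (e x) = e x := LinearMap.congr_fun hee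
  have hei' : ∀ x, e (j x) = j x := LinearMap.congr_fun hei
  let i : M →ₗ[R] LinearMap.range e :=
    j.codRestrict _ fun x => ⟨_, hei' x⟩
  have hfix : ∀ x : LinearMap.range e, e x = x := by
    rintro ⟨_, x, rfl⟩
    exact hee' x
  have hi : ConeatHom i := by
    refine ConeatHom.of_comp (g := (LinearMap.range e).subtype) ?_
    exact hj
  refine ⟨LinearMap.range e, inferInstance, inferInstance, i, ?_, ?_, ?_⟩
  · exact hP.of_retract (LinearMap.range e).subtype
      e.rangeRestrict (LinearMap.ext fun x => Subtype.ext (hfix x))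
  · intro E' _ _ hE' j
    exact hE'.extend hi j
  · intro f hf
    have hf' : ∀ x, f (i x) = i x := LinearMap.congr_fun hf
    obtain ⟨k, hk, hk'⟩ := he ((LinearMap.range e).subtype ∘ₗ f ∘ₗ e.rangeRestrict) (by
      refine LinearMap.ext fun x => ?_
      change (f (e.rangeRestrict (j x)) : P) = j x
      have : e.rangeRestrict (j x) = i x := Subtype.ext (hei' x)
      rw [this, hf']
      rfl)
    have hF : ∀ x : P,
        (e ∘ₗ ((LinearMap.range e).subtype ∘ₗ f ∘ₗ e.rangeRestrict) ∘ₗ e) x =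
          f (e.rangeRestrict x) := by
      intro x
      have : e.rangeRestrict (e x) = e.rangeRestrict x := Subtype.ext (hee' x)
      change e (f (e.rangeRestrict (e x))) = f (e.rangeRestrict x)
      rw [this, hfix]
    have hr : ∀ x : LinearMap.range e, e.rangeRestrict x = x := fun x => Subtype.ext (hfix x)
    constructor
    · intro x y hxy
      refine Subtype.ext ?_
      have h := fun z : LinearMap.range e => LinearMap.congr_fun hk z
      simp only [LinearMap.comp_apply k] at h
      rw [← hfix x, ← hfix y, ← h x, ← h y, hF, hF, hr, hr, hxy]
    · intro y
      refine ⟨e.rangeRestrict (k y), Subtype.ext ?_⟩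
      rw [← hF]
      exact (LinearMap.congr_fun hk' (y : P)).trans (hfix y)

/-- The product of character modules must lie in the universe of `M`, hence `max u v`. -/
theorem exists_isConeatInjectiveEnvelope (M : Type (max u v)) [AddCommGroup M] [Module R M] :
    ∃ (E : Type (max u v)) (_ : AddCommGroup E) (_ : Module R E) (i : M →ₗ[R] E),
      IsConeatInjectiveEnvelope i :=
  exists_isConeatInjectiveEnvelope_of_compact (coneatHom_toCharProduct R M)
    (isConeatInjective_charProduct R M)

end

/-! ### Essential extensions and the characterizations of the envelope -/

section
variable {R : Type u} [Ring R]

/-- The coneat embedding of `M` into its product of character modules factors through `i`, and a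
first factor of a coneat map is coneat. -/
theorem IsConeatInjectiveEnvelope.coneatHom {M E : Type (max u v)} [AddCommGroup M] [Module R M]
    [AddCommGroup E] [Module R E] {i : M →ₗ[R] E} (h : IsConeatInjectiveEnvelope i) :
    ConeatHom i := by
  obtain ⟨g, hg⟩ := h.factors (CharProduct R M) (isConeatInjective_charProduct R M)
    (toCharProduct R M)
  exact ConeatHom.of_comp (g := g) (hg ▸ coneatHom_toCharProduct R M)

theorem isConeatEssential_iff {B : Type w} [AddCommGroup B] [Module R B] (A : Submodule R B) :
    IsConeatEssential A ↔ ConeatHom A.subtype ∧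
      ∀ (X : Type w) [AddCommGroup X] [Module R X] (φ : B →ₗ[R] X),
        ConeatHom (φ.rangeRestrict ∘ₗ A.subtype) → Function.Injective φ := by
  have hr : ∀ (X : Type w) [AddCommGroup X] [Module R X] (φ : B →ₗ[R] X),
      LinearMap.range (φ.rangeRestrict ∘ₗ A.subtype) = A.map φ.rangeRestrict := fun X _ _ φ => by
    rw [LinearMap.range_comp, Submodule.range_subtype]
  refine and_congr (isConeat_iff_coneatHom A) (forall_congr' fun X => forall_congr' fun _ =>
    forall_congr' fun _ => forall_congr' fun φ => ⟨fun h hφ => ?_, fun h hinj hφ => ?_⟩)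
  · refine h ?_ ?_
    · exact Subtype.val_injective.comp hφ.injective
    · rw [← hr]
      exact hφ.isConeat_range
  · refine h ((coneatHom_iff_of_injective ?_).2 ?_)
    · exact Function.Injective.of_comp (f := Subtype.val) hinj
    · rwa [hr]

theorem IsConeatEssential.coneatHom {B : Type w} [AddCommGroup B] [Module R B]
    {A : Submodule R B} (h : IsConeatEssential A) : ConeatHom A.subtype :=
  ((isConeatEssential_iff A).1 h).1

theorem IsConeatEssential.injective {B X : Type w} [AddCommGroup B] [Module R B]
    [AddCommGroup X] [Module R X] {A : Submodule R B} (h : IsConeatEssential A) (φ : B →ₗ[R] X)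
    (hφ : ConeatHom (φ ∘ₗ A.subtype)) : Function.Injective φ := by
  refine ((isConeatEssential_iff A).1 h).2 X φ ?_
  exact ConeatHom.of_comp (g := (LinearMap.range φ).subtype) hφ

theorem IsConeatInjectiveEnvelope.isConeatEssential {M E : Type (max u v)} [AddCommGroup M]
    [Module R M] [AddCommGroup E] [Module R E] {i : M →ₗ[R] E}
    (h : IsConeatInjectiveEnvelope i) : IsConeatEssential (LinearMap.range i) := by
  refine (isConeatEssential_iff _).2
    ⟨(isConeat_iff_coneatHom _).1 h.coneatHom.isConeat_range, fun X _ _ φ hφ => ?_⟩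
  have hφi : ConeatHom (φ.rangeRestrict ∘ₗ i) := fun m =>
    (extendsAlong_equiv_comp _ (LinearEquiv.ofInjective i h.coneatHom.injective) _ rfl).2 (hφ m)
  -- Extending `i` back along `φ ∘ i` gives an endomorphism `k ∘ φ` fixing `i`, hence bijective, so
  -- `φ` is injective.
  obtain ⟨k, hk⟩ := h.coneatInjective.extend hφi i
  have hb := h.bijective (k ∘ₗ φ.rangeRestrict) hk
  intro x y hxy
  refine hb.1 ?_
  have : φ.rangeRestrict x = φ.rangeRestrict y := Subtype.ext hxy
  simp only [LinearMap.comp_apply, this]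

theorem IsConeatInjectiveEnvelope.comp_equiv {M E F : Type w} [AddCommGroup M] [Module R M]
    [AddCommGroup E] [Module R E] [AddCommGroup F] [Module R F] {i : M →ₗ[R] E}
    (h : IsConeatInjectiveEnvelope i) (e : E ≃ₗ[R] F) {j : M →ₗ[R] F}
    (hj : e.toLinearMap ∘ₗ i = j) : IsConeatInjectiveEnvelope j := by
  subst hj
  refine ⟨h.coneatInjective.of_equiv e, fun E' _ _ hE' k => ?_, fun f hf => ?_⟩
  · obtain ⟨g, hg⟩ := h.factors E' hE' k
    refine ⟨g ∘ₗ e.symm.toLinearMap, ?_⟩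
    rw [← hg]
    ext x
    simp
  · have hb := h.bijective (e.symm.toLinearMap ∘ₗ f ∘ₗ e.toLinearMap) (by
      refine LinearMap.ext fun x => ?_
      have := LinearMap.congr_fun hf x
      simp only [LinearMap.comp_apply, LinearEquiv.coe_coe] at this ⊢
      rw [this, e.symm_apply_apply])
    have hfe : ⇑f = e ∘ (e.symm.toLinearMap ∘ₗ f ∘ₗ e.toLinearMap) ∘ e.symm := by
      ext x
      simp
    rw [hfe]
    exact e.bijective.comp (hb.comp e.symm.bijective)

theorem IsConeatInjectiveEnvelope.of_bijective {M E F : Type w} [AddCommGroup M] [Module R M]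
    [AddCommGroup E] [Module R E] [AddCommGroup F] [Module R F] {i : M →ₗ[R] E}
    (h : IsConeatInjectiveEnvelope i) {j : M →ₗ[R] F} (g : E →ₗ[R] F) (hg : g ∘ₗ i = j)
    (hb : Function.Bijective g) : IsConeatInjectiveEnvelope j :=
  h.comp_equiv (LinearEquiv.ofBijective g hb) hg

/-- `k ∘ g` fixes `i`, so it is bijective; `k` is then onto as well as injective, which makes `g`
bijective. -/
theorem IsConeatInjectiveEnvelope.of_injective_left {M E F : Type w} [AddCommGroup M] [Module R M]
    [AddCommGroup E] [Module R E] [AddCommGroup F] [Module R F] {i : M →ₗ[R] E}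
    (h : IsConeatInjectiveEnvelope i) {j : M →ₗ[R] F} (g : E →ₗ[R] F) (hg : g ∘ₗ i = j)
    (k : F →ₗ[R] E) (hk : k ∘ₗ j = i) (hinj : Function.Injective k) :
    IsConeatInjectiveEnvelope j := by
  have hb : Function.Bijective (k ∘ g) :=
    h.bijective (k ∘ₗ g) (by rw [LinearMap.comp_assoc, hg, hk])
  exact h.of_bijective g hg ((Function.Bijective.of_comp_iff' ⟨hinj, hb.2.of_comp⟩ g).1 hb)

theorem IsConeatEssential.isConeatInjectiveEnvelope {C : Type (max u v)} [AddCommGroup C]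
    [Module R C] {A : Submodule R C} (hC : IsConeatInjective R C) (hA : IsConeatEssential A) :
    IsConeatInjectiveEnvelope A.subtype := by
  obtain ⟨E, _, _, i, hi⟩ := exists_isConeatInjectiveEnvelope.{u, v} (R := R) A
  obtain ⟨g, hg⟩ := hi.factors C hC A.subtype
  obtain ⟨k, hk⟩ := hi.coneatInjective.extend hA.coneatHom i
  exact hi.of_injective_left g hg k hk (hA.injective k (hk ▸ hi.coneatHom))

theorem IsConeatInjectiveEnvelope.isConeatEssential_submodule {C : Type (max u v)}
    [AddCommGroup C] [Module R C] {A : Submodule R C}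
    (h : IsConeatInjectiveEnvelope A.subtype) : IsConeatEssential A := by
  have hr := h.isConeatEssential
  rwa [Submodule.range_subtype] at hr

theorem IsConeatInjectiveEnvelope.isSmallestConeatInjective {C : Type (max u v)}
    [AddCommGroup C] [Module R C] {A : Submodule R C}
    (h : IsConeatInjectiveEnvelope A.subtype) : IsSmallestConeatInjective A := by
  refine ⟨h.coneatInjective, h.isConeatEssential_submodule.1, fun D _ _ j hD hj hr => ?_⟩
  obtain ⟨g, hg⟩ := h.factors D hD j
  exact ⟨g, h.isConeatEssential_submodule.injective g
    (hg ▸ (coneatHom_iff_of_injective hj).2 hr), hg⟩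

theorem IsSmallestConeatInjective.isConeatInjectiveEnvelope {C : Type (max u v)}
    [AddCommGroup C] [Module R C] {A : Submodule R C} (h : IsSmallestConeatInjective A) :
    IsConeatInjectiveEnvelope A.subtype := by
  obtain ⟨E, _, _, i, hi⟩ := exists_isConeatInjectiveEnvelope.{u, v} (R := R) A
  obtain ⟨g, hg⟩ := hi.factors C h.1 A.subtype
  obtain ⟨k, hk, hki⟩ := h.2.2 E i hi.coneatInjective hi.coneatHom.injective
    hi.coneatHom.isConeat_range
  exact hi.of_injective_left g hg k hki hk

theorem coneatHom_inclusion_iff {C : Type w} [AddCommGroup C] [Module R C] {A D : Submodule R C}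
    (hAD : A ≤ D) : IsConeat (A.submoduleOf D) ↔ ConeatHom (Submodule.inclusion hAD) := by
  rw [coneatHom_iff_of_injective (Submodule.inclusion_injective hAD), Submodule.range_inclusion]
  rfl

theorem IsConeatInjectiveEnvelope.isMinimalConeatInjective {C : Type (max u v)}
    [AddCommGroup C] [Module R C] {A : Submodule R C}
    (h : IsConeatInjectiveEnvelope A.subtype) : IsMinimalConeatInjective A := by
  refine ⟨h.coneatInjective, h.isConeatEssential_submodule.1, fun D hAD hD _ => ?_⟩
  obtain ⟨p, hp⟩ := h.factors D hD (Submodule.inclusion hAD)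
  have hb := h.bijective (D.subtype ∘ₗ p) (by rw [LinearMap.comp_assoc, hp]; rfl)
  refine eq_top_iff.2 fun x _ => ?_
  obtain ⟨y, rfl⟩ := hb.2 x
  exact (p y).2

/-- The envelope embeds over `A` by `g`. Its image is coneat injective and contains `A` as a coneat
submodule, since `A` is already coneat in `C`; minimality makes `g` onto. -/
theorem IsMinimalConeatInjective.isConeatInjectiveEnvelope {C : Type (max u v)}
    [AddCommGroup C] [Module R C] {A : Submodule R C} (h : IsMinimalConeatInjective A) :
    IsConeatInjectiveEnvelope A.subtype := by
  obtain ⟨E, _, _, i, hi⟩ := exists_isConeatInjectiveEnvelope.{u, v} (R := R) A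
  have hA := (isConeat_iff_coneatHom A).1 h.2.1
  obtain ⟨g, hg⟩ := hi.factors C h.1 A.subtype
  obtain ⟨k, hk⟩ := hi.coneatInjective.extend hA i
  have hb : Function.Bijective (k ∘ g) :=
    hi.bijective (k ∘ₗ g) (by rw [LinearMap.comp_assoc, hg, hk])
  have hinj : Function.Injective g := hb.1.of_comp
  have hAD : A ≤ LinearMap.range g := fun a ha => ⟨i ⟨a, ha⟩, LinearMap.congr_fun hg ⟨a, ha⟩⟩
  refine hi.of_bijective g hg ⟨hinj, LinearMap.range_eq_top.1 (h.2.2 _ hAD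
    (hi.coneatInjective.of_equiv (LinearEquiv.ofInjective g hinj))
    ((coneatHom_inclusion_iff hAD).2 ?_))⟩
  exact ConeatHom.of_comp (g := (LinearMap.range g).subtype) hA

theorem IsConeatInjectiveEnvelope.isMaximalConeatEssential {C : Type (max u v)}
    [AddCommGroup C] [Module R C] {A : Submodule R C}
    (h : IsConeatInjectiveEnvelope A.subtype) : IsMaximalConeatEssential A := by
  refine ⟨h.isConeatEssential_submodule, fun D _ _ k hk hess => ?_⟩
  have hA := h.isConeatEssential_submodule.coneatHom
  have hinj : Function.Injective (k ∘ₗ A.subtype) := hk.comp A.subtype_injective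
  have hkA : ConeatHom (k ∘ₗ A.subtype) := by
    rw [coneatHom_iff_of_injective hinj, LinearMap.range_comp, Submodule.range_subtype]
    exact hess.1
  -- Essentiality of `D` makes `p : D → C` injective, while `p ∘ k` fixes `A` and so is onto;
  -- together these force `k` to be onto.
  obtain ⟨p, hp⟩ := h.coneatInjective.extend hkA A.subtype
  have hpinj : Function.Injective p := by
    refine hess.injective p fun m => ?_
    exact (extendsAlong_equiv_comp A.subtype (A.equivMapOfInjective k hk) _ hp).1 (hA m)
  have hb := h.bijective (p ∘ₗ k) hp
  intro d
  obtain ⟨c, hc⟩ := hb.2 (p d)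
  exact ⟨c, hpinj hc⟩

/-- Essentiality embeds `C` over `A` into the envelope, itself an essential extension of `A`;
maximality leaves no room for it to be larger. -/
theorem IsMaximalConeatEssential.isConeatInjectiveEnvelope {C : Type (max u v)}
    [AddCommGroup C] [Module R C] {A : Submodule R C} (h : IsMaximalConeatEssential A) :
    IsConeatInjectiveEnvelope A.subtype := by
  obtain ⟨E, _, _, i, hi⟩ := exists_isConeatInjectiveEnvelope.{u, v} (R := R) A
  obtain ⟨k, hk⟩ := hi.coneatInjective.extend h.1.coneatHom i
  have hinj : Function.Injective k := h.1.injective k (hk ▸ hi.coneatHom)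
  have hsurj := h.2 E k hinj (by
    have : A.map k = LinearMap.range i := by
      rw [← hk, LinearMap.range_comp, Submodule.range_subtype]
    rw [this]
    exact hi.isConeatEssential)
  let e := LinearEquiv.ofBijective k ⟨hinj, hsurj⟩
  refine hi.comp_equiv e.symm (LinearMap.ext fun a => ?_)
  refine (LinearEquiv.symm_apply_eq e).2 ?_
  exact (LinearMap.congr_fun hk a).symm

end

theorem mainTheorem7 (R : Type u) [Ring R] :
    (∀ (M : Type (max u v)) [AddCommGroup M] [Module R M],
      (∃ (E : Type (max u v)) (_ : AddCommGroup E) (_ : Module R E) (i : M →ₗ[R] E),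
        IsConeatInjectiveEnvelope i) ∧
      ∀ (E : Type (max u v)) [AddCommGroup E] [Module R E] (i : M →ₗ[R] E),
        IsConeatInjectiveEnvelope i →
          Function.Injective i ∧ IsConeatEssential (LinearMap.range i)) ∧
    ∀ (C : Type (max u v)) [AddCommGroup C] [Module R C] (A : Submodule R C),
      List.TFAE [
        IsConeatInjectiveEnvelope A.subtype,
        IsConeatInjective R C ∧ IsConeatEssential A,
        IsSmallestConeatInjective A,
        IsMinimalConeatInjective A,
        IsMaximalConeatEssential A] := by
  refine ⟨fun M _ _ => ⟨exists_isConeatInjectiveEnvelope.{u, v} M, fun E _ _ i hi =>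
    ⟨hi.coneatHom.injective, hi.isConeatEssential⟩⟩, fun C _ _ A => ?_⟩
  tfae_have 1 → 2 := fun h => ⟨h.coneatInjective, h.isConeatEssential_submodule⟩
  tfae_have 2 → 1 := fun h => h.2.isConeatInjectiveEnvelope h.1
  tfae_have 1 → 3 := fun h => h.isSmallestConeatInjective
  tfae_have 3 → 1 := fun h => h.isConeatInjectiveEnvelope
  tfae_have 1 → 4 := fun h => h.isMinimalConeatInjective
  tfae_have 4 → 1 := fun h => h.isConeatInjectiveEnvelope
  tfae_have 1 → 5 := fun h => h.isMaximalConeatEssential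
  tfae_have 5 → 1 := fun h => h.isConeatInjectiveEnvelope
  tfae_finish
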